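/- For a real number $x$ and $A\subseteq\mathbb N=\{0,1,2,\dots\}$ let $x\ast A=\{xa \bmod 1 : a\in A\}\subseteq[0,1)$, ordered as a subset of the real line, and write $x\ast A\simeq\alpha$ if this ordered set has order type $\alpha$. Let $k\ge 1$, let $x_0,\dots,x_{k-1}$ be irrational numbers such that $1,x_0,\dots,x_{k-1}$ are linearly independent over $\mathbb Q$, and let $\alpha_0,\dots,\alpha_{k-1}$ be countable (finite or infinite) order types, all of the same cardinality (as is automatic if $k=1$ or if all $\alpha_i$ are infinite, and as is necessary, since $|x_i\ast A|=|A|$ for every $i$). (i) There is a set $A\subseteq\mathbb N$ with $x_i\ast A\simeq\alpha_i$ for every $i\in\{0,\dots,k-1\}$. Moreover, for any $\Psi:\mathbb N\to\mathbb N$ with $\Psi(n)\to\infty$, such an $A$ can be chosen with $|A\cap[0,n)|\le\Psi(n)$ for all $n\in\mathbb N$. (ii) Suppose that every $\alpha_i$ is an ordinal (the order type of a well-order). Then every $A\subseteq\mathbb N$ with $x_i\ast A\simeq\alpha_i$ for every $i$ has natural density $0$, that is, $|A\cap[0,n)|/n\to0$. If moreover the $\alpha_i$ are infinite, then for any $\Theta:\mathbb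 N\to\mathbb N$ with $\Theta(n)/n\to0$ there is a set $A\subseteq\mathbb N$ with $x_i\ast A\simeq\alpha_i$ for every $i$ and with $|A\cap[0,n)|>\Theta(n)$ for infinitely many $n\in\mathbb N$. -/

import Mathlib

open Filter Topology

noncomputable section

/-- The set `x ∗ A = {x a mod 1 : a ∈ A} ⊆ [0, 1)`, ordered as a subset of the real line. -/
def dilateModOne (x : ℝ) (A : Set ℕ) : Set ℝ :=
  (fun a : ℕ => Int.fract (x * (a : ℝ))) '' A

/-- The counting function `|A ∩ [0, n)|`. -/
def countBelow (A : Set ℕ) (n : ℕ) : ℕ :=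
  (A ∩ Set.Ico 0 n).ncard

/-- `A` has natural (asymptotic) density `d`. -/
def HasNatDensity (A : Set ℕ) (d : ℝ) : Prop :=
  Tendsto (fun n : ℕ => (countBelow A n : ℝ) / (n : ℝ)) atTop (𝓝 d)

/-- `x i ∗ A ≃ α i` for every `i`: the order type of `x i ∗ A` is that of `α i`. -/
def RealizesOrderTypes {k : ℕ} (x : Fin k → ℝ) (α : Fin k → Type*) [∀ i, LinearOrder (α i)]
    (A : Set ℕ) : Prop :=
  ∀ i, Nonempty (dilateModOne (x i) A ≃o α i)

end

/-!
Disjoint open intervals `J i a` in `[0, 1]`, ordered as `α i`, are attached to the elements `a` of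
each `α i`, and the `α i` are enumerated by a common index set through bijections `e i`. Since
`1, x 0, …, x (k - 1)` are linearly independent over `ℚ`, the sequence of the `n * x` is
equidistributed on the torus, so every box `∏ i, J i (e i m)` is visited for a set of `n` of
positive lower density (`exists_pos_mul_le_countBelow_box`). One visit for each index `m` gives a
set `A` with all the required order types, and the visits may be as late as one likes, so that `A`
is as sparse as one likes (`exists_realizes_sparse`).

If the `α i` are infinite ordinals, each has an initial segment of type `ω`, and an order type does
not change when elements of this segment are replaced by finite nonempty chains
(`nonempty_orderIso_of_finite_fibers`). The bijections are chosen such that infinitely many indices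
`m` fall into these segments for all `i` at once. For such `m` all visits below a bound `N m` are
put into `A`, which for large `N m` are more than `Θ (N m)` (`exists_realizes_dense`).

Conversely, if `x ∗ A` is well-ordered, then each point of the line is followed by a gap of `x ∗ A`,
while a short interval contributes a set of small density. Hence density `0` propagates from the
left end of `[0, 1)` to the right end (`hasNatDensity_zero_of_isWF`).
-/

/-! ### Equidistribution on the torus -/

open MeasureTheory in
/-- The averages are normalized geometric sums with ratio `mFourier n g ≠ 1`. -/
theorem tendsto_orbitAverage_mFourier {d : Type*} [Fintype d] (g : UnitAddTorus d) (n : d → ℤ)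
    (hn : UnitAddTorus.mFourier n g ≠ 1) :
    Tendsto (fun N : ℕ => (N : ℂ)⁻¹ * ∑ j ∈ Finset.range N, UnitAddTorus.mFourier n (j • g))
      atTop (𝓝 0) := by
  set c := UnitAddTorus.mFourier n g with hc
  have hpow : ∀ j : ℕ, UnitAddTorus.mFourier n (j • g) = c ^ j := by
    intro j
    simp only [hc, UnitAddTorus.mFourier, ContinuousMap.coe_mk, Pi.smul_apply, fourier_apply,
      ← Finset.prod_pow]
    refine Finset.prod_congr rfl fun i _ => ?_
    rw [smul_comm, AddCircle.toCircle_nsmul, Circle.coe_pow]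
  have hcn : ‖c‖ ≤ 1 := by
    rw [← UnitAddTorus.mFourier_norm (n := n)]
    exact ContinuousMap.norm_coe_le_norm _ _
  have h1 : 0 < ‖c - 1‖ := norm_pos_iff.mpr (sub_ne_zero.mpr hn)
  refine squeeze_zero_norm (a := fun N : ℕ => (2 / ‖c - 1‖) * (N : ℝ)⁻¹) (fun N => ?_) ?_
  · simp_rw [hpow]
    rw [geom_sum_eq hn, norm_mul, norm_inv, Complex.norm_natCast, norm_div, mul_comm]
    gcongr
    calc ‖c ^ N - 1‖ ≤ ‖c ^ N‖ + ‖(1 : ℂ)‖ := norm_sub_le _ _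
      _ ≤ 1 + 1 := by
        rw [norm_pow, norm_one]
        gcongr
        exact pow_le_one₀ (norm_nonneg _) hcn
      _ = 2 := by norm_num
  · simpa using (tendsto_inv_atTop_nhds_zero_nat (𝕜 := ℝ)).const_mul (2 / ‖c - 1‖)

/-- Characters of the torus are multiplicative in the point. -/
theorem mFourier_add_apply {d : Type*} [Fintype d] (n : d → ℤ) (y g : UnitAddTorus d) :
    UnitAddTorus.mFourier n (y + g) = UnitAddTorus.mFourier n y * UnitAddTorus.mFourier n g := by
  simp only [UnitAddTorus.mFourier, ContinuousMap.coe_mk, Pi.add_apply, fourier_apply,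
    ← Finset.prod_mul_distrib, smul_add, AddCircle.toCircle_add, Circle.coe_mul]

open MeasureTheory in
theorem volume_real_univ_unitAddTorus {d : Type*} [Fintype d] :
    (volume : Measure (UnitAddTorus d)).real Set.univ = 1 := by
  rw [Measure.real, volume_pi, Measure.pi_univ]
  simp

open MeasureTheory in
/-- Translating by `g` multiplies the integral by the value of the character at `g`. -/
theorem integral_mFourier_eq_zero {d : Type*} [Fintype d] (g : UnitAddTorus d) (n : d → ℤ)
    (hn : UnitAddTorus.mFourier n g ≠ 1) : ∫ y, UnitAddTorus.mFourier n y = 0 := by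
  have h := integral_add_right_eq_self (μ := (volume : Measure (UnitAddTorus d)))
    (fun y => UnitAddTorus.mFourier n y) g
  simp_rw [mFourier_add_apply, integral_mul_const] at h
  by_contra h0
  exact hn (mul_left_cancel₀ h0 (by rw [h, mul_one]))

open MeasureTheory in
/-- Weyl's equidistribution theorem on a torus: if no nontrivial character is trivial at `g`, the
averages of a continuous function along the multiples of `g` tend to its integral. The averages
and the integral are `1`-Lipschitz for the sup norm, so the case of characters suffices, by the
density of trigonometric polynomials. -/
theorem tendsto_orbitAverage {d : Type*} [Fintype d] (g : UnitAddTorus d)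
    (hg : ∀ n : d → ℤ, n ≠ 0 → UnitAddTorus.mFourier n g ≠ 1) (f : C(UnitAddTorus d, ℂ)) :
    Tendsto (fun N : ℕ => (N : ℂ)⁻¹ * ∑ j ∈ Finset.range N, f (j • g)) atTop
      (𝓝 (∫ y, f y)) := by
  have hint : ∀ f : C(UnitAddTorus d, ℂ), Integrable (fun y => f y) := fun f =>
    f.continuous.integrable_of_hasCompactSupport (HasCompactSupport.of_compactSpace _)
  have key : ∀ p ∈ Submodule.span ℂ (Set.range (UnitAddTorus.mFourier (d := d))),
      Tendsto (fun N : ℕ => (N : ℂ)⁻¹ * ∑ j ∈ Finset.range N, p (j • g)) atTop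
        (𝓝 (∫ y, p y)) := by
    intro p hp
    induction hp using Submodule.span_induction with
    | mem p hp =>
      obtain ⟨n, rfl⟩ := hp
      by_cases h0 : n = 0
      · subst h0
        refine tendsto_const_nhds.congr' ?_
        filter_upwards [eventually_ne_atTop 0] with N hN
        have : (N : ℂ) ≠ 0 := by exact_mod_cast hN
        simp [UnitAddTorus.mFourier_zero, this, volume_real_univ_unitAddTorus]
      · rw [integral_mFourier_eq_zero g n (hg n h0)]
        exact tendsto_orbitAverage_mFourier g n (hg n h0)
    | zero => simp
    | add p q _ _ hp hq =>
      have := hp.add hq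
      simp only [ContinuousMap.add_apply, Finset.sum_add_distrib, mul_add]
      rwa [integral_add (hint p) (hint q)]
    | smul c p _ hp =>
      have := hp.const_mul c
      simp only [ContinuousMap.smul_apply, smul_eq_mul, ← Finset.mul_sum]
      rw [integral_const_mul]
      exact this.congr fun N => by ring
  rw [Metric.tendsto_atTop]
  intro ε hε
  have hf : f ∈ closure ((Submodule.span ℂ (Set.range (UnitAddTorus.mFourier (d := d))) :
      Submodule ℂ C(UnitAddTorus d, ℂ)) : Set C(UnitAddTorus d, ℂ)) := by
    rw [← Submodule.topologicalClosure_coe, UnitAddTorus.span_mFourier_closure_eq_top]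
    trivial
  obtain ⟨p, hp, hfp⟩ := Metric.mem_closure_iff.mp hf (ε / 3) (by positivity)
  obtain ⟨N₀, hN₀⟩ := Metric.tendsto_atTop.mp (key p hp) (ε / 3) (by positivity)
  have hle : ∀ y, ‖f y - p y‖ ≤ ε / 3 := fun y => by
    rw [← dist_eq_norm]
    exact (ContinuousMap.dist_apply_le_dist y).trans hfp.le
  refine ⟨N₀, fun N hN => ?_⟩
  have h1 : dist ((N : ℂ)⁻¹ * ∑ j ∈ Finset.range N, f (j • g))
      ((N : ℂ)⁻¹ * ∑ j ∈ Finset.range N, p (j • g)) ≤ ε / 3 := by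
    rw [dist_eq_norm, ← mul_sub, ← Finset.sum_sub_distrib, norm_mul, norm_inv,
      Complex.norm_natCast]
    have : ‖∑ j ∈ Finset.range N, (f (j • g) - p (j • g))‖ ≤ N * (ε / 3) := by
      refine (norm_sum_le_of_le _ fun j _ => hle _).trans ?_
      simp
    rcases Nat.eq_zero_or_pos N with rfl | hpos
    · simp; positivity
    · rw [inv_mul_le_iff₀ (by exact_mod_cast hpos)]
      exact this
  have h2 : dist (∫ y, p y) (∫ y, f y) ≤ ε / 3 := by
    rw [dist_comm, dist_eq_norm, ← integral_sub (hint f) (hint p)]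
    refine (norm_integral_le_of_norm_le_const (Eventually.of_forall hle)).trans ?_
    rw [volume_real_univ_unitAddTorus, mul_one]
  have h3 := hN₀ N hN
  have h4 := dist_triangle4 ((N : ℂ)⁻¹ * ∑ j ∈ Finset.range N, f (j • g))
      ((N : ℂ)⁻¹ * ∑ j ∈ Finset.range N, p (j • g)) (∫ y, p y) (∫ y, f y)
  linarith

open MeasureTheory in
/-- An equidistributed orbit visits every nonempty open set with positive lower density: the number
of visits dominates the sum of a bump function supported in the open set. -/
theorem exists_pos_mul_le_card_visits {d : Type*} [Fintype d] (g : UnitAddTorus d)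
    (hg : ∀ n : d → ℤ, n ≠ 0 → UnitAddTorus.mFourier n g ≠ 1) {U : Set (UnitAddTorus d)}
    (hU : IsOpen U) (hne : U.Nonempty) :
    ∃ c : ℝ, 0 < c ∧ ∀ᶠ N : ℕ in atTop,
      c * N ≤ (({j : ℕ | j • g ∈ U} ∩ Set.Ico 0 N).ncard : ℝ) := by
  obtain ⟨y₀, hy₀⟩ := hne
  obtain ⟨φ, h0, h1, h01⟩ := exists_continuous_zero_one_of_isClosed hU.isClosed_compl
    (isClosed_singleton (x := y₀)) (by simpa using hy₀)
  have hpos : 0 < ∫ y, φ y :=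
    φ.continuous.integral_pos_of_hasCompactSupport_nonneg_nonzero
      (HasCompactSupport.of_compactSpace _) (fun y => (h01 y).1) (x := y₀)
      (by rw [h1 (Set.mem_singleton y₀)]; simp)
  have hlim := tendsto_orbitAverage g hg ⟨fun y => (φ y : ℂ), by fun_prop⟩
  simp only [ContinuousMap.coe_mk, integral_complex_ofReal] at hlim
  have hlim' : Tendsto (fun N : ℕ => (N : ℝ)⁻¹ * ∑ j ∈ Finset.range N, φ (j • g)) atTop
      (𝓝 (∫ y, φ y)) := by
    have := (Complex.continuous_re.tendsto _).comp hlim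
    rw [Complex.ofReal_re] at this
    refine this.congr fun N => ?_
    simp only [Function.comp]
    rw [← Complex.ofReal_natCast, ← Complex.ofReal_inv, ← Complex.ofReal_sum,
      ← Complex.ofReal_mul, Complex.ofReal_re]
  refine ⟨(∫ y, φ y) / 2, by positivity, ?_⟩
  filter_upwards [hlim'.eventually (lt_mem_nhds (half_lt_self hpos)), eventually_gt_atTop 0]
    with N hN hN0
  have hN0' : (0 : ℝ) < N := by exact_mod_cast hN0
  rw [lt_inv_mul_iff₀ hN0', mul_comm] at hN
  refine hN.le.trans ?_
  classical
  have hset : {j : ℕ | j • g ∈ U} ∩ Set.Ico 0 N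
      = ((Finset.range N).filter fun j => j • g ∈ U : Finset ℕ) := by
    ext j; simp [and_comm]
  rw [hset, Set.ncard_coe_finset, Finset.card_filter, Nat.cast_sum]
  refine Finset.sum_le_sum fun j _ => ?_
  by_cases hj : j • g ∈ U
  · simpa [hj] using (h01 (j • g)).2
  · simp [hj, h0 (show j • g ∈ Uᶜ from hj)]

/-- A relation `mFourier n x = 1` says that `∑ i, n i * x i` is an integer. -/
theorem mFourier_ne_one_of_linearIndependent {k : ℕ} (x : Fin k → ℝ)
    (hx : LinearIndependent ℚ (Fin.cons 1 x : Fin (k + 1) → ℝ)) (n : Fin k → ℤ) (hn : n ≠ 0) :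
    UnitAddTorus.mFourier n (fun i => (x i : UnitAddCircle)) ≠ 1 := by
  intro h
  apply hn
  simp only [UnitAddTorus.mFourier, ContinuousMap.coe_mk, fourier_coe_apply] at h
  rw [← Complex.exp_sum, Complex.exp_eq_one_iff] at h
  obtain ⟨m, hm⟩ := h
  have h2 : (∑ i, (n i : ℝ) * x i) = m := by
    have h3 : (2 * Real.pi * Complex.I) * (∑ i, (n i : ℂ) * x i) =
        (2 * Real.pi * Complex.I) * m := by
      rw [Finset.mul_sum, mul_comm _ (m : ℂ), ← hm]
      refine Finset.sum_congr rfl fun i _ => ?_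
      simp; ring
    have h4 := mul_left_cancel₀ Complex.two_pi_I_ne_zero h3
    exact_mod_cast h4
  rw [Fintype.linearIndependent_iff] at hx
  have h5 := hx (Fin.cons (-(m : ℚ)) fun i => (n i : ℚ)) (by
    rw [Fin.sum_univ_succ]
    simp [Rat.smul_def, h2])
  funext i
  simpa using h5 i.succ

/-- Every open box of `[0, 1)ᵏ` is visited by the sequence of fractional parts of `n * x` for a set
of `n` of positive lower density. -/
theorem exists_pos_mul_le_countBelow_box {k : ℕ} (x : Fin k → ℝ)
    (hx : LinearIndependent ℚ (Fin.cons 1 x : Fin (k + 1) → ℝ)) (l u : Fin k → ℝ)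
    (hl : ∀ i, 0 ≤ l i) (hlu : ∀ i, l i < u i) (hu : ∀ i, u i ≤ 1) :
    ∃ c : ℝ, 0 < c ∧ ∀ᶠ N : ℕ in atTop,
      c * N ≤ countBelow {n : ℕ | ∀ i, Int.fract (x i * n) ∈ Set.Ioo (l i) (u i)} N := by
  set U : Set (UnitAddTorus (Fin k)) :=
    Set.univ.pi fun i => (fun t : ℝ => (t : UnitAddCircle)) '' Set.Ioo (l i) (u i)
  have hU : IsOpen U := isOpen_set_pi Set.finite_univ fun i _ =>
    QuotientAddGroup.isOpenMap_coe _ isOpen_Ioo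
  have hne : U.Nonempty := Set.univ_pi_nonempty_iff.mpr fun i =>
    (Set.nonempty_Ioo.mpr (hlu i)).image _
  obtain ⟨c, hc, h⟩ := exists_pos_mul_le_card_visits (fun i => (x i : UnitAddCircle))
    (mFourier_ne_one_of_linearIndependent x hx) hU hne
  refine ⟨c, hc, h.mono fun N hN => hN.trans ?_⟩
  unfold countBelow
  refine Nat.cast_le.mpr ?_
  refine Set.ncard_le_ncard (Set.inter_subset_inter_left _ fun j hj i => ?_)
    ((Set.finite_Ico 0 N).inter_of_right _)
  obtain ⟨t, ht, hte⟩ := hj i (Set.mem_univ i)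
  have hfr : t = Int.fract (x i * j) := by
    have e1 : (t : UnitAddCircle) = ((Int.fract (x i * j) : ℝ) : UnitAddCircle) := by
      refine hte.trans ?_
      rw [Pi.smul_apply, ← AddCircle.coe_nsmul, nsmul_eq_mul, mul_comm]
      rw [← sub_eq_zero, ← AddCircle.coe_sub, Int.self_sub_fract, AddCircle.coe_eq_zero_iff]
      exact ⟨⌊x i * j⌋, by simp⟩
    refine (AddCircle.coe_eq_coe_iff_of_mem_Ico (p := 1) (a := 0) ?_ ?_).mp e1
    · exact ⟨(hl i).trans ht.1.le, by simpa using ht.2.trans_le (hu i)⟩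
    · exact ⟨Int.fract_nonneg _, by simpa using Int.fract_lt_one _⟩
  rw [← hfr]
  exact ht

/-! ### Sets of density zero -/

theorem countBelow_mono {A B : Set ℕ} (h : A ⊆ B) (N : ℕ) : countBelow A N ≤ countBelow B N :=
  Set.ncard_le_ncard (Set.inter_subset_inter_left _ h) ((Set.finite_Ico 0 N).inter_of_right _)

theorem countBelow_union_le (A B : Set ℕ) (N : ℕ) :
    countBelow (A ∪ B) N ≤ countBelow A N + countBelow B N := by
  unfold countBelow
  rw [Set.union_inter_distrib_right]
  exact Set.ncard_union_le _ _

/-- For irrational `x`, the times at which the multiples of `x` visit a short enough interval are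
more than `M` apart, since the multiples `m * x` with `1 ≤ m ≤ M` stay away from the integers. -/
theorem exists_pos_countBelow_le_of_fract_mem_Ico {x : ℝ} (hx : Irrational x) {M : ℕ}
    (hM : 0 < M) :
    ∃ η : ℝ, 0 < η ∧ ∀ (A : Set ℕ) (a : ℝ), (∀ n ∈ A, Int.fract (x * n) ∈ Set.Ico a (a + η)) →
      ∀ N, countBelow A N ≤ N / M + 1 := by
  have hpos : ∀ m : ℕ, 0 < m → 0 < |x * m - round (x * m)| := fun m hm => by
    rw [abs_pos, sub_ne_zero]
    exact (hx.mul_natCast hm.ne').ne_int _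
  obtain ⟨η, hη, hle⟩ : ∃ η : ℝ, 0 < η ∧ ∀ m ∈ Finset.Icc 1 M, η ≤ |x * m - round (x * m)| := by
    rcases (Finset.Icc 1 M).eq_empty_or_nonempty with h | h
    · exact ⟨1, one_pos, by simp [h]⟩
    · obtain ⟨m, hm, hmin⟩ := Finset.exists_min_image _ (fun m : ℕ => |x * m - round (x * m)|) h
      exact ⟨_, hpos m (Finset.mem_Icc.mp hm).1, hmin⟩
  refine ⟨η, hη, fun A a hA N => ?_⟩
  have hsep : ∀ n ∈ A, ∀ n' ∈ A, n < n' → n + M < n' := by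
    intro n hn n' hn' hlt
    by_contra! hle'
    obtain ⟨m, rfl⟩ := Nat.exists_eq_add_of_lt hlt
    have h1 := hle (m + 1) (by simp; omega)
    have h2 := round_le (x * (m + 1 : ℕ)) (⌊x * (n + m + 1 : ℕ)⌋ - ⌊x * n⌋)
    have h3 := hA n hn
    have h4 := hA _ hn'
    rw [Int.fract] at h3 h4
    have h5 : |x * (m + 1 : ℕ) - ((⌊x * (n + m + 1 : ℕ)⌋ - ⌊x * n⌋ : ℤ) : ℝ)| < η := by
      push_cast at h3 h4 ⊢
      rw [abs_lt]
      constructor <;> linarith [h3.1, h3.2, h4.1, h4.2]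
    linarith
  -- Elements more than `M` apart have different quotients by `M`.
  have hinj : Set.InjOn (fun n => n / M) (A ∩ Set.Ico 0 N) := by
    intro n hn n' hn' h
    simp only at h
    have aux : ∀ p q : ℕ, p + M < q → p / M ≠ q / M := by
      intro p q hpq he
      have := Nat.div_le_div_right (c := M) hpq.le
      rw [Nat.add_div_right _ hM] at this
      omega
    rcases lt_trichotomy n n' with h' | h' | h'
    · exact absurd h (aux _ _ (hsep _ hn.1 _ hn'.1 h'))
    · exact h'
    · exact absurd h.symm (aux _ _ (hsep _ hn'.1 _ hn.1 h'))
  have himg : (fun n => n / M) '' (A ∩ Set.Ico 0 N) ⊆ Set.Iio (N / M + 1) := by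
    rintro _ ⟨n, hn, rfl⟩
    exact Nat.lt_succ_of_le (Nat.div_le_div_right hn.2.2.le)
  calc countBelow A N = ((fun n => n / M) '' (A ∩ Set.Ico 0 N)).ncard :=
        hinj.ncard_image.symm
    _ ≤ (Set.Iio (N / M + 1)).ncard := Set.ncard_le_ncard himg (Set.finite_Iio _)
    _ = N / M + 1 := by simp [Set.ncard_eq_toFinset_card']

theorem hasNatDensity_zero_iff {A : Set ℕ} :
    HasNatDensity A 0 ↔ ∀ ε : ℝ, 0 < ε → ∀ᶠ N : ℕ in atTop, (countBelow A N : ℝ) ≤ ε * N := by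
  unfold HasNatDensity
  constructor
  · intro h ε hε
    filter_upwards [h.eventually (gt_mem_nhds hε), eventually_gt_atTop 0] with N hN h0
    rw [div_lt_iff₀ (by exact_mod_cast h0)] at hN
    exact hN.le
  · intro h
    rw [Metric.tendsto_atTop']
    intro ε hε
    obtain ⟨N₀, hN₀⟩ := eventually_atTop.mp (h (ε / 2) (by positivity))
    refine ⟨N₀, fun N hN => ?_⟩
    have h0 : (0 : ℝ) < N := by exact_mod_cast (Nat.zero_le _).trans_lt hN
    rw [Real.dist_eq, sub_zero, abs_of_nonneg (by positivity), div_lt_iff₀ h0]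
    nlinarith [hN₀ N hN.le]

/-- If `x ∗ A` is well-ordered, then `A` has density `0`. The set `S` of the thresholds `t` for
which `{n ∈ A | fract (x * n) < t}` has density `0` is a down-set, and it cannot have a finite
supremum `σ`: the part of `x ∗ A` between `σ - η / 2` and its first element `w` above `σ` lies in
an interval of length `η`, which contributes little, so that `w` is in `S` too. -/
theorem hasNatDensity_zero_of_isWF {x : ℝ} (hx : Irrational x) {A : Set ℕ}
    (hA : (dilateModOne x A).IsWF) : HasNatDensity A 0 := by
  set B : ℝ → Set ℕ := fun t => {n ∈ A | Int.fract (x * n) < t} with hB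
  have hBmono : ∀ s t, s ≤ t → B s ⊆ B t := fun s t h n hn => ⟨hn.1, hn.2.trans_le h⟩
  set S : Set ℝ := {t | HasNatDensity (B t) 0} with hS
  have hdown : ∀ s t, s ≤ t → t ∈ S → s ∈ S := by
    intro s t hst ht
    rw [hS, Set.mem_ofPred_eq, hasNatDensity_zero_iff] at ht ⊢
    refine fun ε hε => (ht ε hε).mono fun N hN => le_trans ?_ hN
    exact_mod_cast countBelow_mono (hBmono s t hst) N
  -- A gap of `x ∗ A` above `σ` carries the thresholds from below `σ` to its right end.
  have hext : ∀ σ w, (∀ t < σ, t ∈ S) → (∀ y ∈ dilateModOne x A, σ < y → w ≤ y) → w ∈ S := by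
    intro σ w hσ hw
    rw [hS, Set.mem_ofPred_eq, hasNatDensity_zero_iff]
    intro ε hε
    obtain ⟨M, hM⟩ := exists_nat_gt (3 / ε)
    have hMpos : (0 : ℝ) < M := lt_trans (by positivity) hM
    obtain ⟨η, hη, hgap⟩ :=
      exists_pos_countBelow_le_of_fract_mem_Ico hx (Nat.cast_pos.mp hMpos)
    have hleft := hσ (σ - η / 2) (by linarith)
    rw [hS, Set.mem_ofPred_eq, hasNatDensity_zero_iff] at hleft
    filter_upwards [hleft (ε / 3) (by positivity), eventually_ge_atTop ⌈3 / ε⌉₊] with N h1 h2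
    have h3 : B w ⊆ B (σ - η / 2) ∪
        {n ∈ A | Int.fract (x * n) ∈ Set.Ico (σ - η / 2) (σ - η / 2 + η)} := by
      rintro n ⟨hnA, hnw⟩
      rcases lt_or_ge (Int.fract (x * n)) (σ - η / 2) with h | h
      · exact Or.inl ⟨hnA, h⟩
      · refine Or.inr ⟨hnA, h, ?_⟩
        by_contra! hc
        exact absurd (hw _ ⟨n, hnA, rfl⟩ (by linarith)) (not_le.mpr hnw)
    have h4 := (countBelow_mono h3 N).trans (countBelow_union_le _ _ N)
    have h5 := hgap {n ∈ A | Int.fract (x * n) ∈ Set.Ico (σ - η / 2) (σ - η / 2 + η)}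
      (σ - η / 2) (fun n hn => hn.2) N
    have h6 : (countBelow (B w) N : ℝ) ≤ countBelow (B (σ - η / 2)) N + ((N / M : ℕ) + 1) := by
      exact_mod_cast h4.trans (Nat.add_le_add_left h5 _)
    have h7 : ((N / M : ℕ) : ℝ) ≤ ε / 3 * N := by
      refine Nat.cast_div_le.trans ?_
      rw [div_le_iff₀ hMpos]
      have : 1 ≤ ε / 3 * M := by
        rw [div_lt_iff₀ hε] at hM
        linarith
      nlinarith [(Nat.cast_nonneg N : (0 : ℝ) ≤ N)]
    have h8 : 1 ≤ ε / 3 * N := by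
      have := Nat.ceil_le.mp h2
      rw [div_le_iff₀ hε] at this
      linarith
    linarith
  have h1 : (1 : ℝ) ∈ S := by
    by_contra h1
    have hne : S.Nonempty := by
      refine ⟨0, ?_⟩
      have : B 0 = ∅ := by
        ext n
        simp [hB, Int.fract_nonneg]
      rw [hS, Set.mem_ofPred_eq, this]
      simp [HasNatDensity, countBelow]
    have hbdd : BddAbove S := ⟨1, fun t ht => by
      by_contra! h
      exact h1 (hdown 1 t h.le ht)⟩
    have hσ : ∀ t < sSup S, t ∈ S := fun t ht => by
      obtain ⟨s, hs, hts⟩ := exists_lt_of_lt_csSup hne ht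
      exact hdown t s hts.le hs
    by_cases hW : (dilateModOne x A ∩ Set.Ioi (sSup S)).Nonempty
    · have hwf : (dilateModOne x A ∩ Set.Ioi (sSup S)).IsWF := hA.mono Set.inter_subset_left
      have hmin := hwf.min_mem hW
      refine absurd (le_csSup hbdd (hext (sSup S) (hwf.min hW) hσ fun y hy hlt =>
        hwf.min_le hW ⟨hy, hlt⟩)) (not_le.mpr hmin.2)
    · refine absurd (le_csSup hbdd (hext (sSup S) (sSup S + 1) hσ fun y hy hlt =>
        (hW ⟨y, hy, hlt⟩).elim)) (by linarith)
  have : B 1 = A := by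
    ext n
    simp [hB, Int.fract_lt_one]
  rwa [hS, Set.mem_ofPred_eq, this] at h1

/-! ### Well-orders and initial segments of type `ω` -/

/-- The isomorphism counts the predecessors and renumbers the values of this rank. -/
theorem nonempty_orderIso_nat {S : Type*} [LinearOrder S] [Infinite S]
    (h : ∀ s : S, (Set.Iio s).Finite) : Nonempty (S ≃o ℕ) := by
  classical
  have hr : StrictMono fun s : S => (Set.Iio s).ncard := fun s t hst =>
    Set.ncard_lt_ncard (Set.Iio_ssubset_Iio hst) (h t)
  have : Infinite (Set.range fun s : S => (Set.Iio s).ncard) :=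
    (Set.infinite_range_of_injective hr.injective).to_subtype
  exact ⟨(hr.orderIso _).trans (Nat.Subtype.orderIsoOfNat _).symm⟩

/-- An infinite well-order has an initial segment of order type `ω`. -/
theorem exists_nat_initialSeg (α : Type*) [LinearOrder α] [WellFoundedLT α] [Infinite α] :
    ∃ f : ℕ → α, StrictMono f ∧ IsLowerSet (Set.range f) := by
  rcases InitialSeg.total (· < · : ℕ → ℕ → Prop) (· < · : α → α → Prop) with F | G
  · refine ⟨F, fun a b h => F.map_rel_iff.mpr h, ?_⟩
    rintro _ b hb ⟨n, rfl⟩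
    rcases hb.eq_or_lt with rfl | hb
    · exact ⟨n, rfl⟩
    · exact F.mem_range_of_rel hb
  · obtain ⟨e⟩ := nonempty_orderIso_nat (S := α) fun s =>
      ((Set.finite_Iio (G s)).preimage G.injective.injOn).subset fun t ht =>
        G.map_rel_iff.mpr ht
    refine ⟨e.symm, e.symm.strictMono, ?_⟩
    rw [e.symm.surjective.range_eq]
    exact isLowerSet_univ

/-- Replacing the elements of an initial segment of order type `ω` by finite nonempty chains does
not change an order type. Here `f` enumerates the initial segment and `π` maps the enlarged order
onto the original one. -/
theorem nonempty_orderIso_of_finite_fibers {S α : Type*} [LinearOrder S] [LinearOrder α]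
    {f : ℕ → α} (hf : StrictMono f) (hlow : IsLowerSet (Set.range f)) {π : S → α}
    (hmono : Monotone π) (hsurj : Function.Surjective π) (hfin : ∀ j, (π ⁻¹' {f j}).Finite)
    (hinj : ∀ s t, π s = π t → π s ∉ Set.range f → s = t) : Nonempty (S ≃o α) := by
  classical
  set L := {s : S // π s ∈ Set.range f}
  have : Infinite L := by
    choose g hg using fun j => hsurj (f j)
    refine Infinite.of_injective (fun j => (⟨g j, j, (hg j).symm⟩ : L)) fun i j h => ?_
    have h' : g i = g j := congrArg Subtype.val h
    exact hf.injective (by rw [← hg i, ← hg j, h'])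
  have hIio : ∀ s : L, (Set.Iio s).Finite := by
    rintro ⟨s, j, hj⟩
    have h1 : (⋃ i ∈ Set.Iic j, π ⁻¹' {f i}).Finite :=
      (Set.finite_Iic j).biUnion fun i _ => hfin i
    refine (h1.preimage Subtype.val_injective.injOn).subset ?_
    rintro ⟨t, i, hi⟩ ht
    have h2 : f i ≤ f j := by
      rw [hi, hj]
      exact hmono (show t < s from ht).le
    simp only [Set.mem_preimage, Set.mem_iUnion]
    exact ⟨i, hf.le_iff_le.mp h2, hi.symm⟩
  -- `L` has order type `ω`; renumbering it and keeping `π` elsewhere gives the isomorphism.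
  obtain ⟨θ⟩ := nonempty_orderIso_nat hIio
  set h : S → α := fun s => if hs : π s ∈ Set.range f then f (θ ⟨s, hs⟩) else π s with hdef
  have hpos : ∀ s (hs : π s ∈ Set.range f), h s = f (θ ⟨s, hs⟩) := fun s hs => dif_pos hs
  have hneg : ∀ s (hs : π s ∉ Set.range f), h s = π s := fun s hs => dif_neg hs
  have hstrict : StrictMono h := by
    intro s t hst
    by_cases ht : π t ∈ Set.range f
    · have hs : π s ∈ Set.range f := hlow (hmono hst.le) ht
      rw [hpos s hs, hpos t ht]
      exact hf (θ.strictMono hst)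
    · rw [hneg t ht]
      by_cases hs : π s ∈ Set.range f
      · rw [hpos s hs]
        by_contra! hle
        exact ht (hlow hle ⟨_, rfl⟩)
      · rw [hneg s hs]
        exact (hmono hst.le).lt_of_ne fun he => hst.ne (hinj s t he hs)
  refine ⟨hstrict.orderIsoOfSurjective h fun a => ?_⟩
  by_cases ha : a ∈ Set.range f
  · obtain ⟨j, rfl⟩ := ha
    exact ⟨(θ.symm j).1, by rw [hpos _ (θ.symm j).2]; simp⟩
  · obtain ⟨s, rfl⟩ := hsurj a
    exact ⟨s, hneg s ha⟩

/-! ### Order types of unions of visits to ordered boxes -/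

/-- A countable order can be represented by disjoint open intervals in `[0, 1]`: their end points
come from an order embedding of the lexicographic product with `Bool`. -/
theorem exists_ordered_intervals (α : Type*) [LinearOrder α] [Countable α] :
    ∃ l u : α → ℝ, (∀ a, 0 ≤ l a) ∧ (∀ a, l a < u a) ∧ (∀ a, u a ≤ 1) ∧
      ∀ a b, a < b → u a ≤ l b := by
  have : Countable (α ×ₗ Bool) := inferInstanceAs (Countable (α × Bool))
  obtain ⟨g⟩ := Order.embedding_from_countable_to_dense (α ×ₗ Bool) (Set.Icc (0 : ℝ) 1)
  refine ⟨fun a => g (toLex (a, false)), fun a => g (toLex (a, true)),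
    fun a => (g _).2.1, fun a => ?_, fun a => (g _).2.2, fun a b hab => ?_⟩
  · exact g.strictMono (by simp [Prod.Lex.toLex_lt_toLex])
  · exact g.monotone (by simp [Prod.Lex.toLex_le_toLex, hab])

/-- If the points of `x ∗ F m` lie in the interval assigned to `e m`, for disjoint intervals
ordered as `α`, then `x ∗ ⋃ m, F m` is obtained from `α` by replacing `e m` with `x ∗ F m`. -/
theorem exists_monotone_surjective_of_fract_mem {x : ℝ} {α ι : Type*} [LinearOrder α]
    (e : ι ≃ α) {l u : α → ℝ} (hlu : ∀ a b, a < b → u a ≤ l b) {F : ι → Set ℕ}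
    (hne : ∀ m, (F m).Nonempty)
    (hF : ∀ m, ∀ n ∈ F m, Int.fract (x * n) ∈ Set.Ioo (l (e m)) (u (e m))) :
    ∃ π : dilateModOne x (⋃ m, F m) → α, Monotone π ∧ Function.Surjective π ∧
      ∀ m s, π s = e m → s.1 ∈ dilateModOne x (F m) := by
  have hmem : ∀ s : dilateModOne x (⋃ m, F m), ∃ m, s.1 ∈ dilateModOne x (F m) := by
    rintro ⟨_, n, hn, rfl⟩
    obtain ⟨m, hm⟩ := Set.mem_iUnion.mp hn
    exact ⟨m, n, hm, rfl⟩
  choose p hp using hmem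
  have hIoo : ∀ m, ∀ s ∈ dilateModOne x (F m), s ∈ Set.Ioo (l (e m)) (u (e m)) := by
    rintro m _ ⟨n, hn, rfl⟩
    exact hF m n hn
  have hle : ∀ m m' s t, s ∈ dilateModOne x (F m) → t ∈ dilateModOne x (F m') → s ≤ t →
      e m ≤ e m' := by
    intro m m' s t hs ht hst
    by_contra! h
    have := hlu _ _ h
    linarith [(hIoo m s hs).1, (hIoo m' t ht).2]
  refine ⟨fun s => e (p s), fun s t hst => hle _ _ _ _ (hp s) (hp t) hst, fun a => ?_,
    fun m s h => e.injective h ▸ hp s⟩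
  obtain ⟨m, rfl⟩ := e.surjective a
  obtain ⟨n, hn⟩ := hne m
  have hs : Int.fract (x * n) ∈ dilateModOne x (F m) := ⟨n, hn, rfl⟩
  refine ⟨⟨Int.fract (x * n), n, Set.mem_iUnion.mpr ⟨m, hn⟩, rfl⟩, ?_⟩
  exact le_antisymm (hle _ _ _ _ (hp _) hs le_rfl) (hle _ _ _ _ hs (hp _) le_rfl)

/-- An injective sequence whose range has infinite complement extends to an enumeration. -/
theorem exists_equiv_sum_nat {α : Type*} [Countable α] {g : ℕ → α} (hg : g.Injective)
    (hc : (Set.range g)ᶜ.Infinite) : ∃ e : ℕ ⊕ ℕ ≃ α, ∀ m, e (Sum.inl m) = g m := by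
  classical
  have := hc.to_subtype
  obtain ⟨e₂⟩ := nonempty_equiv_of_countable (α := ℕ) (β := ((Set.range g)ᶜ : Set α))
  exact ⟨((Equiv.ofInjective g hg).sumCongr e₂).trans (Equiv.Set.sumCompl _), fun m => rfl⟩

theorem exists_le_mem_of_mul_le_countBelow {G : Set ℕ} {c : ℝ} (hc : 0 < c)
    (h : ∀ᶠ N : ℕ in atTop, c * N ≤ countBelow G N) (b : ℕ) : ∃ n ∈ G, b ≤ n := by
  by_contra! hb
  have hle : ∀ N, countBelow G N ≤ b := fun N => by
    calc countBelow G N ≤ (Set.Iio b).ncard :=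
          Set.ncard_le_ncard (fun n hn => hb n hn.1) (Set.finite_Iio b)
      _ = b := by simp [Set.ncard_eq_toFinset_card']
  obtain ⟨N, hN, hN'⟩ := (h.and (eventually_gt_atTop ⌈b / c⌉₊)).exists
  have h1 := (Nat.lt_of_ceil_lt hN')
  rw [div_lt_iff₀ hc] at h1
  have h2 : (countBelow G N : ℝ) ≤ b := by exact_mod_cast hle N
  linarith

/-! ### Sparse and dense realizations -/

/-- One visit to the box of each index suffices. Postponing the visit of the index numbered `j`
until `Ψ` stays above `j` bounds the counting function by `Ψ`. -/
theorem exists_realizes_sparse {k : ℕ} (hk : 0 < k) (x : Fin k → ℝ)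
    (hx : LinearIndependent ℚ (Fin.cons 1 x : Fin (k + 1) → ℝ))
    (α : Fin k → Type*) [∀ i, LinearOrder (α i)] [∀ i, Countable (α i)]
    (hcard : ∀ i j, Nonempty (α i ≃ α j)) (Ψ : ℕ → ℕ) (hΨ : Tendsto Ψ atTop atTop) :
    ∃ A : Set ℕ, RealizesOrderTypes x α A ∧ ∀ n : ℕ, countBelow A n ≤ Ψ n := by
  choose l u hl hlu hu hlt using fun i => exists_ordered_intervals (α i)
  let ι := α ⟨0, hk⟩
  have e : ∀ i, ι ≃ α i := fun i => (hcard _ i).some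
  obtain ⟨enc, henc⟩ := exists_injective_nat ι
  have hpt : ∀ m : ι, ∃ n : ℕ, (∀ i, Int.fract (x i * n) ∈ Set.Ioo (l i (e i m)) (u i (e i m))) ∧
      ∀ n' ≥ n, enc m < Ψ n' := by
    intro m
    obtain ⟨c, hc, h⟩ := exists_pos_mul_le_countBelow_box x hx (fun i => l i (e i m))
      (fun i => u i (e i m)) (fun i => hl i _) (fun i => hlu i _) (fun i => hu i _)
    obtain ⟨b, hb⟩ := eventually_atTop.mp (hΨ.eventually (eventually_gt_atTop (enc m)))
    obtain ⟨n, hn, hbn⟩ := exists_le_mem_of_mul_le_countBelow hc h b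
    exact ⟨n, hn, fun n' hn' => hb n' (hbn.trans hn')⟩
  choose p hp hpΨ using hpt
  refine ⟨⋃ m, {p m}, fun i => ?_, fun n => ?_⟩
  · obtain ⟨π, hmono, hsurj, hfib⟩ := exists_monotone_surjective_of_fract_mem (x := x i) (e i)
      (hlt i) (F := fun m => {p m}) (fun m => Set.singleton_nonempty _) (by
        rintro m n rfl
        exact hp m i)
    refine ⟨(hmono.strictMono_of_injective fun s t hst => ?_).orderIsoOfSurjective π hsurj⟩
    obtain ⟨m, hm⟩ := (e i).surjective (π s)
    have h1 := hfib m s hm.symm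
    have h2 := hfib m t (by rw [← hst, hm])
    simp only [dilateModOne, Set.image_singleton, Set.mem_singleton_iff] at h1 h2
    exact Subtype.ext (h1.trans h2.symm)
  · have hsub : enc '' {m | p m < n} ⊆ Set.Iio (Ψ n) := by
      rintro _ ⟨m, hm, rfl⟩
      exact hpΨ m n (le_of_lt hm)
    have hfin : {m | p m < n}.Finite :=
      ((Set.finite_Iio _).subset hsub).of_finite_image henc.injOn
    calc countBelow (⋃ m, {p m}) n ≤ (p '' {m | p m < n}).ncard := by
          refine Set.ncard_le_ncard ?_ (hfin.image _)
          rintro q ⟨hq, hqn⟩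
          obtain ⟨m, rfl⟩ := Set.mem_iUnion.mp hq
          exact ⟨m, hqn.2, rfl⟩
      _ ≤ {m | p m < n}.ncard := Set.ncard_image_le hfin
      _ = (enc '' {m | p m < n}).ncard := (Set.ncard_image_of_injective _ henc).symm
      _ ≤ (Set.Iio (Ψ n)).ncard := Set.ncard_le_ncard hsub (Set.finite_Iio _)
      _ = Ψ n := by simp [Set.ncard_eq_toFinset_card']

/-- For indices that correspond to elements of the initial segment of type `ω` in every `α i`, all
visits to the box up to a late time `N` are taken. They are a positive proportion of the integers
below `N`, hence more than `Θ N`, and they do not affect the order types. -/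
theorem exists_realizes_dense {k : ℕ} (x : Fin k → ℝ)
    (hx : LinearIndependent ℚ (Fin.cons 1 x : Fin (k + 1) → ℝ))
    (α : Fin k → Type*) [∀ i, LinearOrder (α i)] [∀ i, Countable (α i)]
    [∀ i, WellFoundedLT (α i)] [∀ i, Infinite (α i)] (Θ : ℕ → ℕ)
    (hΘ : Tendsto (fun n : ℕ => (Θ n : ℝ) / (n : ℝ)) atTop (𝓝 0)) :
    ∃ A : Set ℕ, RealizesOrderTypes x α A ∧ {n : ℕ | Θ n < countBelow A n}.Infinite := by
  choose l u hl hlu hu hlt using fun i => exists_ordered_intervals (α i)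
  choose f hf hlow using fun i => exists_nat_initialSeg (α i)
  -- The left summand enumerates the even places of the initial segments of type `ω`, for all `i`
  -- simultaneously; the odd places keep the complement infinite.
  have hex : ∀ i, ∃ e : ℕ ⊕ ℕ ≃ α i, ∀ m, e (Sum.inl m) = f i (2 * m) := fun i => by
    refine exists_equiv_sum_nat (g := fun m => f i (2 * m))
      (fun a b h => by have := (hf i).injective h; omega) ?_
    refine Set.infinite_of_injective_forall_mem (f := fun m : ℕ => f i (2 * m + 1))
      (fun a b h => by have := (hf i).injective h; omega) ?_
    rintro m ⟨m', h⟩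
    have := (hf i).injective h
    omega
  choose e he using hex
  set G : ℕ ⊕ ℕ → Set ℕ := fun m =>
    {n | ∀ i, Int.fract (x i * n) ∈ Set.Ioo (l i (e i m)) (u i (e i m))} with hG
  have hbox : ∀ m, ∃ c : ℝ, 0 < c ∧ ∀ᶠ N : ℕ in atTop, c * N ≤ countBelow (G m) N := fun m =>
    exists_pos_mul_le_countBelow_box x hx (fun i => l i (e i m))
      (fun i => u i (e i m)) (fun i => hl i _) (fun i => hlu i _) (fun i => hu i _)
  have hblock : ∀ m : ℕ, ∃ N, m < N ∧ Θ N < countBelow (G (Sum.inl m)) N := fun m => by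
    obtain ⟨c, hc, h⟩ := hbox (Sum.inl m)
    obtain ⟨N, hN, hΘN, hm⟩ := (h.and ((hΘ.eventually (gt_mem_nhds hc)).and
      (eventually_gt_atTop m))).exists
    refine ⟨N, hm, ?_⟩
    rw [div_lt_iff₀ (by exact_mod_cast (Nat.zero_le m).trans_lt hm)] at hΘN
    exact_mod_cast hΘN.trans_le hN
  have hpt : ∀ m : ℕ, ∃ n, n ∈ G (Sum.inr m) := fun m => by
    obtain ⟨c, hc, h⟩ := hbox (Sum.inr m)
    obtain ⟨n, hn, -⟩ := exists_le_mem_of_mul_le_countBelow hc h 0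
    exact ⟨n, hn⟩
  choose N hN hΘN using hblock
  choose p hp using hpt
  set F : ℕ ⊕ ℕ → Set ℕ :=
    Sum.elim (fun m => G (Sum.inl m) ∩ Set.Ico 0 (N m)) (fun m => {p m}) with hFdef
  have hFG : ∀ m, F m ⊆ G m := by
    rintro (m | m)
    · exact Set.inter_subset_left
    · exact Set.singleton_subset_iff.mpr (hp m)
  have hFfin : ∀ m, (F m).Finite := by
    rintro (m | m)
    · exact (Set.finite_Ico 0 (N m)).inter_of_right _
    · exact Set.finite_singleton _
  have hFne : ∀ m, (F m).Nonempty := by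
    rintro (m | m)
    · exact Set.nonempty_of_ncard_ne_zero ((Nat.zero_le _).trans_lt (hΘN m)).ne'
    · exact Set.singleton_nonempty _
  refine ⟨⋃ m, F m, fun i => ?_, ?_⟩
  · obtain ⟨π, hmono, hsurj, hfib⟩ := exists_monotone_surjective_of_fract_mem (x := x i) (e i)
      (hlt i) hFne fun m n hn => hFG m hn i
    refine nonempty_orderIso_of_finite_fibers (hf i) (hlow i) hmono hsurj (fun j => ?_) ?_
    · obtain ⟨m, hm⟩ := (e i).surjective (f i j)
      have hfin : (dilateModOne (x i) (F m)).Finite := (hFfin m).image _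
      refine (hfin.preimage Subtype.val_injective.injOn).subset fun s hs => ?_
      exact hfib m s (hs.trans hm.symm)
    · intro s t hst hs
      obtain ⟨m | m, hm⟩ := (e i).surjective (π s)
      · exact (hs ⟨2 * m, by rw [← hm, he]⟩).elim
      · have h1 := hfib _ s hm.symm
        have h2 := hfib _ t (by rw [← hst, hm])
        simp only [hFdef, Sum.elim_inr, dilateModOne, Set.image_singleton,
          Set.mem_singleton_iff] at h1 h2
        exact Subtype.ext (h1.trans h2.symm)
  · refine Set.infinite_of_forall_exists_gt fun m => ⟨N m, ?_, hN m⟩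
    refine (hΘN m).trans_le (Set.ncard_le_ncard ?_ ((Set.finite_Ico 0 (N m)).inter_of_right _))
    exact fun n hn => ⟨Set.mem_iUnion.mpr ⟨Sum.inl m, hn⟩, hn.2⟩

theorem theorem1 {k : ℕ} (hk : 0 < k) (x : Fin k → ℝ) (hirr : ∀ i, Irrational (x i))
    (hx : LinearIndependent ℚ (Fin.cons 1 x : Fin (k + 1) → ℝ))
    (α : Fin k → Type*) [∀ i, LinearOrder (α i)] [∀ i, Countable (α i)]
    (hcard : ∀ i j, Nonempty (α i ≃ α j)) :
    (∃ A : Set ℕ, RealizesOrderTypes x α A) ∧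
    (∀ Ψ : ℕ → ℕ, Tendsto Ψ atTop atTop →
      ∃ A : Set ℕ, RealizesOrderTypes x α A ∧ ∀ n : ℕ, countBelow A n ≤ Ψ n) ∧
    ((∀ i, WellFoundedLT (α i)) →
      (∀ A : Set ℕ, RealizesOrderTypes x α A → HasNatDensity A 0) ∧
      ((∀ i, Infinite (α i)) →
        ∀ Θ : ℕ → ℕ, Tendsto (fun n : ℕ => (Θ n : ℝ) / (n : ℝ)) atTop (𝓝 0) →
          ∃ A : Set ℕ, RealizesOrderTypes x α A ∧
            {n : ℕ | Θ n < countBelow A n}.Infinite)) := by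
  refine ⟨?_, fun Ψ hΨ => exists_realizes_sparse hk x hx α hcard Ψ hΨ, fun hwf => ⟨?_, ?_⟩⟩
  · obtain ⟨A, hA, -⟩ := exists_realizes_sparse hk x hx α hcard id tendsto_id
    exact ⟨A, hA⟩
  · intro A hA
    obtain ⟨o⟩ := hA ⟨0, hk⟩
    refine hasNatDensity_zero_of_isWF (hirr ⟨0, hk⟩) ?_
    exact (o.toOrderEmbedding.wellFoundedLT).wf
  · intro hinf Θ hΘ
    exact exists_realizes_dense x hx α Θ hΘ
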